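/- Let $p,q,s\in[0,1]$ and put $\alpha=p-q$. The minimal random walk with parameters $p,q,s$ is $X_0=0$, $X_n=\eta_1+\dots+\eta_n$, where the steps $\eta_k$ take values in $\{0,1\}$ and are generated as follows. $\mathbb P(\eta_1=1)=s$. For each $n\ge 1$, given the whole history up to time $n$, an index $n'$ is chosen uniformly at random from $\{1,\dots,n\}$; then, given the history and $n'$, $\eta_{n+1}=1$ with probability $p$ if $\eta_{n'}=1$ and with probability $q$ if $\eta_{n'}=0$, and $\eta_{n+1}=0$ otherwise. Assume $p<1$, $q>0$ and $\alpha\le 1/2$. (a) If $\alpha<1/2$, then, as $n\to\infty$, $$\frac{X_n-\frac{q}{1-\alpha}n}{\sqrt n}\ \xrightarrow{d}\ N\!\left(0,\ \frac{q(1-p)}{(1-\alpha)^2(1-2\alpha)}\right).$$ (b) If $\alpha=1/2$, then, as $n\to\infty$, $$\frac{X_n-2qn}{\sqrt{n\log n}}\ \xrightarrow{d}\ N\big(0,\ 4q(1-p)\big).$$ Here $N(0,v)$ is the normal law with mean $0$ and variance $v$. -/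

import Mathlib

open MeasureTheory ProbabilityTheory Filter Topology

/-- The position `X_n = η_1 + ⋯ + η_n` of the walk with steps `η_1, η_2, …` (so `X_0 = 0`).
The value `η 0` is never used. -/
def walkPosition {Ω : Type*} (η : ℕ → Ω → ℕ) (n : ℕ) (ω : Ω) : ℕ :=
  ∑ k ∈ Finset.Icc 1 n, η k ω

/-- The history of the walk up to time `n`: the σ-algebra generated by the steps `η_1, …, η_n` and
by the memory choices `U_1, …, U_{n-1}` that were made to determine the steps `η_2, …, η_n`. -/
abbrev walkHistory {Ω : Type*} (η U : ℕ → Ω → ℕ) (n : ℕ) : MeasurableSpace Ω :=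
  (⨆ k ∈ Finset.Icc 1 n, MeasurableSpace.comap (η k) ⊤) ⊔
    (⨆ k ∈ Finset.Ico 1 n, MeasurableSpace.comap (U k) ⊤)

/-- The steps `η_1, η_2, …` and the memory choices `U_1, U_2, …` form a minimal random walk with
parameters `p`, `q`, `s` on the probability space `(Ω, P)`; `U_n` is the past time in
`{1, …, n}` that the walker remembers when it makes the step `η_{n+1}`. -/
structure IsMinimalRandomWalk {Ω : Type*} [MeasurableSpace Ω] (P : Measure Ω) (p q s : ℝ)
    (η U : ℕ → Ω → ℕ) : Prop where
  measurable_step : ∀ n, 1 ≤ n → Measurable (η n)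
  measurable_memory : ∀ n, 1 ≤ n → Measurable (U n)
  /-- Every step is `0` or `1`. -/
  step_mem : ∀ n, 1 ≤ n → ∀ ω, η n ω = 0 ∨ η n ω = 1
  /-- The first step is `1` with probability `s` (hence `0` with probability `1 - s`). -/
  first_step : P.real {ω | η 1 ω = 1} = s
  /-- Given the history up to time `n`, the remembered time is uniform on `{1, …, n}`. -/
  memory_uniform : ∀ n, 1 ≤ n → ∀ m ∈ Finset.Icc 1 n,
    P⟦{ω | U n ω = m} | walkHistory η U n⟧ =ᵐ[P] fun _ => 1 / (n : ℝ)
  /-- Given the history up to time `n` and the remembered time `U_n`, the next step is `1` with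
  probability `p` if the remembered step is `1`, and with probability `q` if it is `0`. -/
  next_step : ∀ n, 1 ≤ n →
    P⟦{ω | η (n + 1) ω = 1} | walkHistory η U n ⊔ MeasurableSpace.comap (U n) ⊤⟧
      =ᵐ[P] fun ω => if η (U n ω) ω = 1 then p else q

/-! With `c = q / (1 - α)`, the fixed point of `x ↦ q + α x`, put `Y n = X n - c n`. Averaging over
the uniform memory, the next step is Bernoulli with parameter `r = q + α X n / n = c + α Y n / n`,
so `Y (n + 1) = (1 + α / n) Y n` plus a centered Bernoulli noise of variance `r (1 - r)`. A second
moment bound (`integral_sq_centered_le`) gives `r → c` in mean, hence the characteristic functions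
`F n` of `Y n` satisfy `F (n + 1) u ≈ (1 - c (1 - c) u² / 2) F n ((1 + α / n) u)`
(`norm_charFun_centered_succ_sub_le`).

The analytic core is `tendsto_gaussian_of_approx_recursion`. Rescaled by `√(L n)`, where `L (n + 1)
- (1 + α / n)² L n → κ`, one step of the recursion compares the error at `s` with the error at `ρ s`
for some `ρ ≤ 1 - κ / (4 L (n + 1))`. An error bound linear in `|s|` is therefore contracted, and
divergence of `∑ 1 / L n` drives it to zero; the limiting variance is `c (1 - c) / κ`. The choices
`L n = n`, `κ = 1 - 2 α` and `L n = n log n`, `κ = 1` give the two regimes, and Lévy's continuity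
theorem concludes. -/

/-! ### Contracting recursions -/

theorem tendsto_zero_of_le_contraction {x θ ε Λ : ℕ → ℝ} {a : ℝ} (ha : 0 < a)
    (hx0 : ∀ n, 0 ≤ x n) (hθ1 : ∀ n, θ n ≤ 1)
    (hx : ∀ n, x (n + 1) ≤ (1 - θ n) * x n + θ n * ε n) (hθ0 : ∀ n, 0 ≤ θ n)
    (hε : Tendsto ε atTop (𝓝 0)) (hΛ : Tendsto Λ atTop atTop)
    (hθΛ : ∀ n, a * (Λ (n + 1) - Λ n) ≤ θ n) :
    Tendsto x atTop (𝓝 0) := by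
  rw [Metric.tendsto_atTop]
  intro δ hδ
  obtain ⟨N, hN⟩ := eventually_atTop.1 (hε.eventually_le_const (half_pos hδ))
  -- Once `ε n ≤ δ / 2`, the excess over `δ / 2` obeys the homogeneous recursion; with `1 - θ ≤ exp
  -- (-θ)` the product of the factors telescopes in `Λ`.
  set y : ℕ → ℝ := fun n => max (x n - δ / 2) 0 with hy
  have hstep : ∀ n, N ≤ n → y (n + 1) ≤ Real.exp (-(a * (Λ (n + 1) - Λ n))) * y n := by
    intro n hn
    have h1 : 1 - θ n ≤ Real.exp (-(a * (Λ (n + 1) - Λ n))) := by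
      have := Real.add_one_le_exp (-(a * (Λ (n + 1) - Λ n)))
      linarith [hθΛ n]
    have h2 : 0 ≤ y n := le_max_right _ _
    have h3 : x n - δ / 2 ≤ y n := le_max_left _ _
    refine max_le ?_ (by positivity)
    have h4 : x (n + 1) - δ / 2 ≤ (1 - θ n) * (x n - δ / 2) := by
      nlinarith [hx n, mul_le_mul_of_nonneg_left (hN n hn) (hθ0 n)]
    calc x (n + 1) - δ / 2 ≤ (1 - θ n) * (x n - δ / 2) := h4
      _ ≤ (1 - θ n) * y n := mul_le_mul_of_nonneg_left h3 (by linarith [hθ1 n])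
      _ ≤ _ := mul_le_mul_of_nonneg_right h1 h2
  have hbound : ∀ n, N ≤ n → y n ≤ Real.exp (-(a * (Λ n - Λ N))) * y N := by
    intro n hn
    induction n, hn using Nat.le_induction with
    | base => simp
    | succ n hn ih =>
      calc y (n + 1) ≤ Real.exp (-(a * (Λ (n + 1) - Λ n))) * y n := hstep n hn
        _ ≤ Real.exp (-(a * (Λ (n + 1) - Λ n))) * (Real.exp (-(a * (Λ n - Λ N))) * y N) := by
            gcongr
        _ = _ := by rw [← mul_assoc, ← Real.exp_add]; ring_nf
  have hlim : Tendsto (fun n => Real.exp (-(a * (Λ n - Λ N))) * y N) atTop (𝓝 0) := by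
    have h : Tendsto (fun n => a * (Λ n - Λ N)) atTop atTop :=
      (tendsto_atTop_add_const_right _ (-Λ N) hΛ).const_mul_atTop ha
    simpa using (Real.tendsto_exp_neg_atTop_nhds_zero.comp h).mul_const (y N)
  obtain ⟨M, hM⟩ := eventually_atTop.1 (hlim.eventually_lt_const (half_pos hδ))
  refine ⟨max N M, fun n hn => ?_⟩
  have h1 := hbound n (le_of_max_le_left hn)
  have h2 := hM n (le_of_max_le_right hn)
  have h3 : x n - δ / 2 ≤ y n := le_max_left _ _
  rw [Real.dist_eq, sub_zero, abs_of_nonneg (hx0 n)]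
  linarith

/-! ### Taylor bounds for characteristic functions -/

theorem norm_exp_mul_I_sub_quadratic_le {x : ℝ} (hx : |x| ≤ 1) :
    ‖Complex.exp (x * Complex.I) - (1 + x * Complex.I - x ^ 2 / 2)‖ ≤ |x| ^ 3 := by
  have h := Complex.exp_bound (x := (x : ℂ) * Complex.I) (by simpa using hx) (n := 3) (by norm_num)
  have e : ∑ m ∈ Finset.range 3, ((x : ℂ) * Complex.I) ^ m / (m.factorial : ℂ)
      = 1 + x * Complex.I - x ^ 2 / 2 := by
    simp [Finset.sum_range_succ, Nat.factorial, mul_pow]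
    ring
  rw [e] at h
  refine h.trans ?_
  have : ‖(x : ℂ) * Complex.I‖ = |x| := by simp
  rw [this]
  have h3 : (0 : ℝ) ≤ |x| ^ 3 := by positivity
  norm_num [Nat.factorial]
  linarith

/-- Averaging the two second-order expansions with weights `r` and `1 - r` cancels the linear terms
and leaves the variance `r (1 - r)`. -/
theorem norm_centered_bernoulli_charFun_sub_le {r u : ℝ} (hr0 : 0 ≤ r) (hr1 : r ≤ 1)
    (hu : |u| ≤ 1) :
    ‖(r * Complex.exp ((u * (1 - r) : ℝ) * Complex.I)
        + (1 - r) * Complex.exp ((-(u * r) : ℝ) * Complex.I))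
      - ((1 - r * (1 - r) * u ^ 2 / 2 : ℝ) : ℂ)‖ ≤ |u| ^ 3 := by
  have b1 : |u * (1 - r)| ≤ |u| := by
    rw [abs_mul, abs_of_nonneg (by linarith : 0 ≤ 1 - r)]
    exact mul_le_of_le_one_right (abs_nonneg _) (by linarith)
  have b2 : |-(u * r)| ≤ |u| := by
    rw [abs_neg, abs_mul, abs_of_nonneg hr0]
    exact mul_le_of_le_one_right (abs_nonneg _) hr1
  have h1 := (norm_exp_mul_I_sub_quadratic_le (b1.trans hu)).trans
    (pow_le_pow_left₀ (abs_nonneg _) b1 3)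
  have h2 := (norm_exp_mul_I_sub_quadratic_le (b2.trans hu)).trans
    (pow_le_pow_left₀ (abs_nonneg _) b2 3)
  set A := Complex.exp ((u * (1 - r) : ℝ) * Complex.I)
    - (1 + (u * (1 - r) : ℝ) * Complex.I - ((u * (1 - r) : ℝ) : ℂ) ^ 2 / 2) with hA
  set B := Complex.exp ((-(u * r) : ℝ) * Complex.I)
    - (1 + (-(u * r) : ℝ) * Complex.I - ((-(u * r) : ℝ) : ℂ) ^ 2 / 2) with hB
  have e : (r * Complex.exp ((u * (1 - r) : ℝ) * Complex.I)
        + (1 - r) * Complex.exp ((-(u * r) : ℝ) * Complex.I))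
      - ((1 - r * (1 - r) * u ^ 2 / 2 : ℝ) : ℂ) = (r : ℂ) * A + ((1 - r : ℝ) : ℂ) * B := by
    rw [hA, hB]; push_cast; ring
  rw [e]
  calc ‖(r : ℂ) * A + ((1 - r : ℝ) : ℂ) * B‖ ≤ ‖(r : ℂ) * A‖ + ‖((1 - r : ℝ) : ℂ) * B‖ :=
        norm_add_le _ _
    _ = r * ‖A‖ + (1 - r) * ‖B‖ := by
        rw [norm_mul, norm_mul, Complex.norm_real, Complex.norm_real, Real.norm_of_nonneg hr0,
          Real.norm_of_nonneg (by linarith)]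
    _ ≤ r * |u| ^ 3 + (1 - r) * |u| ^ 3 := by
        gcongr
    _ = |u| ^ 3 := by ring

theorem abs_one_sub_sub_exp_neg_le {x y : ℝ} (hy0 : 0 ≤ y) (hy1 : y ≤ 1) :
    |(1 - x) - Real.exp (-y)| ≤ |x - y| + y ^ 2 := by
  have h := Real.norm_exp_sub_one_sub_id_le (x := -y) (by simpa [abs_of_nonneg hy0] using hy1)
  rw [Real.norm_eq_abs, norm_neg, Real.norm_eq_abs, sq_abs] at h
  have e : (1 - x) - Real.exp (-y) = -(x - y) + -(Real.exp (-y) - 1 - -y) := by ring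
  rw [e]
  refine (abs_add_le _ _).trans ?_
  rw [abs_neg, abs_neg]
  linarith

/-! ### Convergence to the Gaussian characteristic function -/

/-- If `G` arises from `F` by adding a small centered step of variance close to `v`, the distance to
the Gaussian characteristic function after normalization contracts up to a small error. -/
theorem norm_sub_gaussian_step {F G : ℝ → ℂ} {b l l' e v κ σ k T : ℝ} (hv0 : 0 ≤ v) (hv1 : v ≤ 1)
    (hκ : 0 < κ) (hb : 0 ≤ b) (he : 0 ≤ e)
    (hFG : ∀ u : ℝ, |u| ≤ 1 →
      ‖G u - ((1 - v * u ^ 2 / 2 : ℝ) : ℂ) * F (b * u)‖ ≤ u ^ 2 * (|u| + e))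
    (hσ0 : 0 ≤ σ) (hσκ : σ * κ = v) (hk : k = l' - b ^ 2 * l) (hLn : 0 < l) (hLT : T ^ 2 ≤ l')
    (hLn1 : 0 < l') (hk1 : κ / 2 ≤ k) (hk2 : k ≤ 2 * κ) :
    ∃ ρ, 0 ≤ ρ ∧ ρ ≤ 1 - κ / (4 * l') ∧ ∀ s : ℝ, |s| ≤ T →
      ‖G (s / √l') - (Real.exp (-σ * s ^ 2 / 2) : ℝ)‖ ≤
        ‖F (ρ * s / √l) - (Real.exp (-σ * (ρ * s) ^ 2 / 2) : ℝ)‖ +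
          |s| * (κ / (4 * l') * ((4 * T / κ) * (2 * (T / √l') + e + σ * |k - κ|))) := by
  have hsq : √l ^ 2 = l := Real.sq_sqrt hLn.le
  have hsq1 : √l' ^ 2 = l' := Real.sq_sqrt hLn1.le
  have hs0 : 0 < √l := Real.sqrt_pos.2 hLn
  have hs1 : 0 < √l' := Real.sqrt_pos.2 hLn1
  -- Chosen so that `b * (s / √l') = ρ * s / √l`; then `ρ² = 1 - k / l'`, which is at most `1 - 2θ ≤
  -- (1 - θ)²` for `θ = κ / (4 l')`.
  set ρ := b * √l / √l' with hρ
  have hρ0 : 0 ≤ ρ := by positivity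
  have hρ2 : ρ ^ 2 = 1 - k / l' := by
    rw [hρ, div_pow, mul_pow, hsq, hsq1, hk]; field_simp; ring
  have hkθ : 2 * (κ / (4 * l')) ≤ k / l' := by
    have : 2 * (κ / (4 * l')) = (κ / 2) / l' := by field_simp; norm_num
    rw [this]; gcongr
  refine ⟨ρ, hρ0, ?_, fun s hs => ?_⟩
  · have h1 : 0 ≤ 1 - κ / (4 * l') := by
      nlinarith [sq_nonneg ρ, show 0 ≤ κ / (4 * l') by positivity]
    refine le_of_sq_le_sq ?_ h1
    nlinarith [sq_nonneg (κ / (4 * l'))]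
  · set u := s / √l' with hu
    have hu2 : u ^ 2 = s ^ 2 / l' := by rw [hu, div_pow, hsq1]
    have huT : |u| ≤ T / √l' := by
      rw [hu, abs_div, abs_of_pos hs1]; gcongr
    have hT0 : 0 ≤ T := (abs_nonneg s).trans hs
    have hT1 : T / √l' ≤ 1 := by
      rw [div_le_one hs1]; exact Real.le_sqrt_of_sq_le hLT
    have hu1 : |u| ≤ 1 := huT.trans hT1
    have hu21 : u ^ 2 ≤ 1 := by rw [← sq_abs]; exact pow_le_one₀ (abs_nonneg _) hu1
    have hβu : b * u = ρ * s / √l := by rw [hu, hρ]; field_simp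
    have h1 := hFG u hu1
    rw [hβu] at h1
    set y := σ * k * u ^ 2 / 2 with hy
    set x := v * u ^ 2 / 2 with hx
    have hy0 : 0 ≤ y := by
      have : 0 ≤ k := by linarith
      positivity
    have hyu : y ≤ u ^ 2 := by
      have h : σ * k ≤ 2 := by
        have : σ * k ≤ σ * (2 * κ) := by gcongr
        linarith
      have := mul_le_mul_of_nonneg_right h (sq_nonneg u)
      linarith
    have hx0 : 0 ≤ x := by positivity
    have hx1 : x ≤ 1 := by
      have := mul_le_one₀ hv1 (sq_nonneg u) hu21
      linarith
    have h2 := abs_one_sub_sub_exp_neg_le (x := x) hy0 (hyu.trans hu21)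
    have hxy : |x - y| ≤ u ^ 2 * (σ * |k - κ|) := by
      have : x - y = -(u ^ 2 * (σ * (k - κ))) / 2 := by rw [hx, hy, ← hσκ]; ring
      rw [this, abs_div, abs_neg, abs_mul, abs_mul, abs_of_nonneg hσ0, abs_of_nonneg (sq_nonneg u)]
      have : 0 ≤ u ^ 2 * (σ * |k - κ|) := by positivity
      norm_num; linarith
    have hy2 : y ^ 2 ≤ u ^ 2 * |u| := by
      have h4 : u ^ 2 ≤ |u| := by
        rw [← sq_abs, sq]; exact mul_le_of_le_one_left (abs_nonneg _) hu1
      calc y ^ 2 = y * y := sq y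
        _ ≤ u ^ 2 * u ^ 2 := by gcongr
        _ ≤ u ^ 2 * |u| := by gcongr
    -- The Gaussian satisfies the same recursion exactly, with factor `exp (-y)` in place of `1 -
    -- x`.
    have hgauss : Real.exp (-σ * s ^ 2 / 2)
        = Real.exp (-y) * Real.exp (-σ * (ρ * s) ^ 2 / 2) := by
      rw [← Real.exp_add]
      congr 1
      rw [mul_pow, hρ2, hy, hu2]; ring
    have h3 : |(1 - x) * Real.exp (-σ * (ρ * s) ^ 2 / 2) - Real.exp (-σ * s ^ 2 / 2)|
        ≤ |(1 - x) - Real.exp (-y)| := by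
      rw [hgauss, ← sub_mul, abs_mul, Real.abs_exp]
      refine mul_le_of_le_one_right (abs_nonneg _) (Real.exp_le_one_iff.2 ?_)
      have : 0 ≤ σ * (ρ * s) ^ 2 := by positivity
      linarith
    have h4 : ‖((1 - x : ℝ) : ℂ) * (F (ρ * s / √l) - (Real.exp (-σ * (ρ * s) ^ 2 / 2) : ℝ))‖
        ≤ ‖F (ρ * s / √l) - (Real.exp (-σ * (ρ * s) ^ 2 / 2) : ℝ)‖ := by
      rw [norm_mul, Complex.norm_real, Real.norm_of_nonneg (by linarith)]
      exact mul_le_of_le_one_left (norm_nonneg _) (by linarith)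
    -- Of the two factors in `s² = |s| * |s|`, one is bounded by `T` and the other kept, so that the
    -- error stays linear in `|s|`.
    have h5 : u ^ 2 * (2 * |u| + e + σ * |k - κ|) ≤ |s| * ((κ / (4 * l')) * ((4 * T / κ) * (2 * (T / √l') + e + σ * |k - κ|))) := by
      have e1 : |s| * ((κ / (4 * l')) * ((4 * T / κ) * (2 * (T / √l') + e + σ * |k - κ|))) = |s| * T / l' *
          (2 * (T / √l') + e + σ * |k - κ|) := by
        field_simp
      have e2 : u ^ 2 ≤ |s| * T / l' := by
        rw [hu2, ← sq_abs, sq]; gcongr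
      rw [e1]
      have := he
      gcongr
    have key : G u - (Real.exp (-σ * s ^ 2 / 2) : ℝ) =
        (G u - ((1 - x : ℝ) : ℂ) * F (ρ * s / √l)) +
        ((1 - x : ℝ) : ℂ) * (F (ρ * s / √l) - (Real.exp (-σ * (ρ * s) ^ 2 / 2) : ℝ)) +
        (((1 - x) * Real.exp (-σ * (ρ * s) ^ 2 / 2) - Real.exp (-σ * s ^ 2 / 2) : ℝ) : ℂ) := by
      push_cast; ring
    rw [key]
    refine (norm_add₃_le).trans ?_
    rw [Complex.norm_real, Real.norm_eq_abs]
    linarith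

/-- Functions satisfying an approximate recursion of the form
`F (n + 1) u ≈ (1 - v u² / 2) F n (β n u)` converge, after normalization by `√(L n)`, to a Gaussian
characteristic function. -/
theorem tendsto_gaussian_of_approx_recursion {F : ℕ → ℝ → ℂ} {β L Λ e : ℕ → ℝ} {v κ : ℝ}
    (hv0 : 0 ≤ v) (hv1 : v ≤ 1) (hκ : 0 < κ) (hβ : ∀ n, 1 ≤ n → 0 ≤ β n)
    (he0 : ∀ n, 0 ≤ e n) (he : Tendsto e atTop (𝓝 0))
    (hF : ∀ n, 1 ≤ n → ∀ u : ℝ, |u| ≤ 1 →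
      ‖F (n + 1) u - ((1 - v * u ^ 2 / 2 : ℝ) : ℂ) * F n (β n * u)‖ ≤ u ^ 2 * (|u| + e n))
    (hFlip : ∀ n, ∃ C : ℝ, 0 ≤ C ∧ ∀ u : ℝ, ‖F n u - 1‖ ≤ C * |u|)
    (hL : Tendsto L atTop atTop)
    (hLκ : Tendsto (fun n => L (n + 1) - β n ^ 2 * L n) atTop (𝓝 κ))
    (hΛ : Tendsto Λ atTop atTop) (hΛL : ∀ᶠ n in atTop, Λ (n + 1) - Λ n ≤ 1 / L (n + 1)) (t : ℝ) :
    Tendsto (fun n => F n (t / √(L n))) atTop (𝓝 (Real.exp (-(v / κ) * t ^ 2 / 2) : ℝ)) := by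
  set T := |t| with hT
  set k : ℕ → ℝ := fun n => L (n + 1) - β n ^ 2 * L n with hk
  set σ := v / κ with hσ
  have hσ0 : 0 ≤ σ := by positivity
  have hσκ : σ * κ = v := by rw [hσ]; field_simp
  have hL1 : Tendsto (fun n => L (n + 1)) atTop atTop := hL.comp (tendsto_add_atTop_nat 1)
  obtain ⟨N, hN⟩ := eventually_atTop.1 ((eventually_ge_atTop 1).and
    ((hL.eventually_gt_atTop 0).and ((hL1.eventually_ge_atTop (T ^ 2)).and
    ((hL1.eventually_gt_atTop 0).and ((hLκ.eventually_const_le (half_lt_self hκ)).and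
    ((hLκ.eventually_le_const (by linarith : κ < 2 * κ)).and hΛL))))))
  set θ : ℕ → ℝ := fun n => κ / (4 * L (n + 1)) with hθ
  set ε : ℕ → ℝ := fun n => (4 * T / κ) * (2 * (T / √(L (n + 1))) + e n + σ * |k n - κ|) with hε
  have hstep : ∀ n, N ≤ n → ∃ ρ, 0 ≤ ρ ∧ ρ ≤ 1 - θ n ∧ ∀ s : ℝ, |s| ≤ T →
      ‖F (n + 1) (s / √(L (n + 1))) - (Real.exp (-σ * s ^ 2 / 2) : ℝ)‖ ≤
        ‖F n (ρ * s / √(L n)) - (Real.exp (-σ * (ρ * s) ^ 2 / 2) : ℝ)‖ + |s| * (θ n * ε n) := by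
    intro n hn
    obtain ⟨hn1, hLn, hLT, hLn1, hk1, hk2, -⟩ := hN n hn
    exact norm_sub_gaussian_step hv0 hv1 hκ (hβ n hn1) (he0 n) (hF n hn1) hσ0 hσκ rfl hLn hLT hLn1
      hk1 hk2
  have hθ0 : ∀ n, N ≤ n → 0 ≤ θ n := fun n hn => by
    have := (hN n hn).2.2.2.1
    positivity
  have hθ1 : ∀ n, N ≤ n → θ n ≤ 1 := fun n hn => by
    obtain ⟨ρ, h0, h1, -⟩ := hstep n hn
    linarith
  have hε0 : ∀ n, 0 ≤ ε n := fun n => by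
    have := he0 n
    positivity
  obtain ⟨C, hC0, hC⟩ := hFlip N
  -- `w j` is the slope in `|s|` of the error bound at time `N + j`; its initial value adds the
  -- Lipschitz constants at `0` of `F N` (rescaled) and of the Gaussian on `|s| ≤ T`.
  let w : ℕ → ℝ := fun j => Nat.rec (C / √(L N) + σ * T)
    (fun j x => (1 - θ (N + j)) * x + θ (N + j) * ε (N + j)) j
  have hw : ∀ j, w (j + 1) = (1 - θ (N + j)) * w j + θ (N + j) * ε (N + j) := fun j => rfl
  have hw0 : ∀ j, 0 ≤ w j := by
    intro j
    induction j with
    | zero => show 0 ≤ C / √(L N) + σ * T; positivity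
    | succ j ih =>
      rw [hw]
      have h1 := hθ0 (N + j) (by omega)
      have h2 := hθ1 (N + j) (by omega)
      have h3 := hε0 (N + j)
      have h4 : 0 ≤ 1 - θ (N + j) := by linarith
      positivity
  have hbound : ∀ j, ∀ s : ℝ, |s| ≤ T →
      ‖F (N + j) (s / √(L (N + j))) - (Real.exp (-σ * s ^ 2 / 2) : ℝ)‖ ≤ w j * |s| := by
    intro j
    induction j with
    | zero =>
      intro s hs
      have hLN := Real.sqrt_pos.2 (hN N le_rfl).2.1
      have h1 := hC (s / √(L N))
      rw [abs_div, abs_of_pos hLN] at h1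
      have h2 : |1 - Real.exp (-σ * s ^ 2 / 2)| ≤ σ * T * |s| := by
        have h3 : Real.exp (-σ * s ^ 2 / 2) ≤ 1 := by
          rw [Real.exp_le_one_iff]; nlinarith [sq_nonneg s]
        have h4 := Real.add_one_le_exp (-σ * s ^ 2 / 2)
        rw [abs_of_nonneg (by linarith)]
        have h5 : σ * s ^ 2 ≤ σ * T * |s| := by
          rw [← sq_abs, sq, mul_assoc]; gcongr
        have : 0 ≤ σ * s ^ 2 := by positivity
        linarith
      have e : F (N + 0) (s / √(L (N + 0))) - (Real.exp (-σ * s ^ 2 / 2) : ℝ) =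
          (F N (s / √(L N)) - 1) + ((1 - Real.exp (-σ * s ^ 2 / 2) : ℝ) : ℂ) := by
        push_cast; simp
      rw [e]
      refine (norm_add_le _ _).trans ?_
      rw [Complex.norm_real, Real.norm_eq_abs]
      show _ ≤ (C / √(L N) + σ * T) * |s|
      have : C * (|s| / √(L N)) = C / √(L N) * |s| := by ring
      linarith
    | succ j ih =>
      intro s hs
      obtain ⟨ρ, h0, h1, h2⟩ := hstep (N + j) (by omega)
      have hθj := hθ0 (N + j) (by omega)
      have h3 : |ρ * s| = ρ * |s| := by rw [abs_mul, abs_of_nonneg h0]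
      have h4 : |ρ * s| ≤ T := by
        rw [h3]; exact (mul_le_of_le_one_left (abs_nonneg _) (by linarith)).trans hs
      have h5 := ih (ρ * s) h4
      rw [h3] at h5
      have h6 : w j * (ρ * |s|) ≤ w j * ((1 - θ (N + j)) * |s|) := by
        have := hw0 j
        gcongr
      rw [hw]
      have := h2 s hs
      rw [← add_assoc]
      nlinarith
  have hε_lim : Tendsto ε atTop (𝓝 0) := by
    have h1 : Tendsto (fun n => T / √(L (n + 1))) atTop (𝓝 0) :=
      (Real.tendsto_sqrt_atTop.comp hL1).const_div_atTop T
    have h2 : Tendsto (fun n => σ * |k n - κ|) atTop (𝓝 0) := by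
      have := ((hLκ.sub_const κ).abs).const_mul σ
      simpa using this
    have := (((h1.const_mul 2).add he).add h2).const_mul (4 * T / κ)
    simpa using this
  have hshift : ∀ {f : ℕ → ℝ} {l : Filter ℝ}, Tendsto f atTop l →
      Tendsto (fun j => f (N + j)) atTop l := fun h =>
    h.comp (tendsto_add_atTop_nat N |>.congr fun j => add_comm _ _)
  have hw_lim : Tendsto w atTop (𝓝 0) := by
    refine tendsto_zero_of_le_contraction (θ := fun j => θ (N + j)) (ε := fun j => ε (N + j))
      (Λ := fun j => Λ (N + j)) (a := κ / 4) (by positivity) hw0 (fun j => hθ1 _ (by omega))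
      (fun j => (hw j).le) (fun j => hθ0 _ (by omega)) (hshift hε_lim) (hshift hΛ) fun j => ?_
    have h1 := (hN (N + j) (by omega)).2.2.2.2.2.2
    calc κ / 4 * (Λ (N + (j + 1)) - Λ (N + j)) ≤ κ / 4 * (1 / L (N + j + 1)) := by
          have : N + (j + 1) = N + j + 1 := rfl
          rw [this]; gcongr
      _ = θ (N + j) := by rw [hθ]; field_simp
  rw [← tendsto_add_atTop_iff_nat N, tendsto_iff_norm_sub_tendsto_zero]
  refine squeeze_zero (fun _ => norm_nonneg _) (fun j => ?_)
    (by simpa using hw_lim.mul_const |t| : Tendsto (fun j => w j * |t|) atTop (𝓝 0))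
  rw [add_comm j N]
  exact hbound j t le_rfl

/-! ### Conditional probabilities and bounded integer variables -/

theorem measureReal_inter_eq_setIntegral {Ω : Type*} {m m0 : MeasurableSpace Ω} {P : Measure Ω}
    [IsFiniteMeasure P] (hm : m ≤ m0) {A E : Set Ω} (hA : MeasurableSet[m] A)
    (hE : MeasurableSet E) {f : Ω → ℝ} (hf : P⟦E | m⟧ =ᵐ[P] f) :
    P.real (A ∩ E) = ∫ ω in A, f ω ∂P := by
  rw [← setIntegral_congr_ae (hm A hA) (hf.mono fun ω h _ => h),
    setIntegral_condExp hm ((integrable_const 1).indicator hE) hA, setIntegral_indicator hE]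
  simp

theorem comp_eq_sum_indicator {Ω E : Type*} [AddCommMonoid E] {X : Ω → ℕ} {n : ℕ}
    (hX : ∀ ω, X ω ≤ n) (g : ℕ → E) :
    (fun ω => g (X ω)) = fun ω => ∑ x ∈ Finset.range (n + 1),
      Set.indicator {ω | X ω = x} (fun _ => g x) ω := by
  funext ω
  rw [Finset.sum_eq_single (X ω)]
  · simp
  · intro x _ hx
    simp [Ne.symm hx]
  · intro h
    exact absurd (Finset.mem_range.2 (Nat.lt_succ_of_le (hX ω))) h

theorem measurableSet_eq_nat {Ω : Type*} [MeasurableSpace Ω] {X : Ω → ℕ} (hX : Measurable X)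
    (x : ℕ) : MeasurableSet {ω | X ω = x} :=
  hX (measurableSet_singleton x)

section BoundedNat

variable {Ω E : Type*} [MeasurableSpace Ω] {P : Measure Ω} [IsFiniteMeasure P]
  [NormedAddCommGroup E] {X : Ω → ℕ} {n : ℕ}

theorem integrable_comp_of_nat_le (hXm : Measurable X) (hX : ∀ ω, X ω ≤ n) (g : ℕ → E) :
    Integrable (fun ω => g (X ω)) P := by
  rw [comp_eq_sum_indicator hX g]
  exact integrable_finsetSum _ fun x _ =>
    (integrable_const _).indicator (measurableSet_eq_nat hXm x)

theorem setIntegral_comp_of_nat_le [NormedSpace ℝ E] [CompleteSpace E] (hXm : Measurable X)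
    (hX : ∀ ω, X ω ≤ n) (g : ℕ → E) (A : Set Ω) :
    ∫ ω in A, g (X ω) ∂P =
      ∑ x ∈ Finset.range (n + 1), P.real ({ω | X ω = x} ∩ A) • g x := by
  rw [comp_eq_sum_indicator hX g, integral_finsetSum _ fun x _ =>
    ((integrable_const _).indicator (measurableSet_eq_nat hXm x))]
  refine Finset.sum_congr rfl fun x _ => ?_
  have hx : MeasurableSet {ω | X ω = x} := measurableSet_eq_nat hXm x
  rw [integral_indicator_const _ hx, measureReal_restrict_apply hx]

end BoundedNat

/-! ### Transition law of the walk -/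

theorem walkPosition_succ {Ω : Type*} (η : ℕ → Ω → ℕ) (n : ℕ) (ω : Ω) :
    walkPosition η (n + 1) ω = walkPosition η n ω + η (n + 1) ω :=
  Finset.sum_Icc_succ_top (by omega) _

theorem comap_step_le_walkHistory {Ω : Type*} (η U : ℕ → Ω → ℕ) {n k : ℕ}
    (hk : k ∈ Finset.Icc 1 n) : MeasurableSpace.comap (η k) ⊤ ≤ walkHistory η U n :=
  (le_iSup₂_of_le (f := fun k (_ : k ∈ Finset.Icc 1 n) => MeasurableSpace.comap (η k) ⊤)
    k hk le_rfl).trans le_sup_left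

theorem measurableSet_walkHistory_step {Ω : Type*} (η U : ℕ → Ω → ℕ) {n k : ℕ}
    (hk : k ∈ Finset.Icc 1 n) (s : Set ℕ) : MeasurableSet[walkHistory η U n] (η k ⁻¹' s) :=
  comap_step_le_walkHistory η U hk _ ⟨s, trivial, rfl⟩

theorem measurableSet_walkHistory_walkPosition {Ω : Type*} (η U : ℕ → Ω → ℕ) (n : ℕ)
    (s : Set ℕ) : MeasurableSet[walkHistory η U n] (walkPosition η n ⁻¹' s) := by
  have h : Measurable[walkHistory η U n] (walkPosition η n) := by
    refine Finset.measurable_fun_sum _ fun k hk => ?_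
    exact fun s _ => measurableSet_walkHistory_step η U hk s
  exact h (MeasurableSet.of_discrete)

namespace IsMinimalRandomWalk

variable {Ω : Type*} [MeasurableSpace Ω] {P : Measure Ω} {p q s : ℝ} {η U : ℕ → Ω → ℕ}

theorem walkHistory_le (hw : IsMinimalRandomWalk P p q s η U) (n : ℕ) :
    walkHistory η U n ≤ ‹MeasurableSpace Ω› := by
  refine sup_le (iSup₂_le fun k hk => ?_) (iSup₂_le fun k hk => ?_)
  · exact (hw.measurable_step k (Finset.mem_Icc.1 hk).1).comap_le
  · exact (hw.measurable_memory k (Finset.mem_Ico.1 hk).1).comap_le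

theorem measurable_walkPosition (hw : IsMinimalRandomWalk P p q s η U) (n : ℕ) :
    Measurable (walkPosition η n) := fun s _ =>
  hw.walkHistory_le n _ (measurableSet_walkHistory_walkPosition η U n s)

theorem walkPosition_le (hw : IsMinimalRandomWalk P p q s η U) (n : ℕ) (ω : Ω) :
    walkPosition η n ω ≤ n := by
  refine (Finset.sum_le_card_nsmul _ _ 1 fun k hk => ?_).trans (by simp)
  rcases hw.step_mem k (Finset.mem_Icc.1 hk).1 ω with h | h <;> omega

variable [IsProbabilityMeasure P]

theorem measureReal_inter_memory (hw : IsMinimalRandomWalk P p q s η U) {n m : ℕ} (hn : 1 ≤ n)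
    (hm : m ∈ Finset.Icc 1 n) {A : Set Ω} (hA : MeasurableSet[walkHistory η U n] A) :
    P.real (A ∩ {ω | U n ω = m}) = P.real A / n := by
  rw [measureReal_inter_eq_setIntegral (hw.walkHistory_le n) hA
    (measurableSet_eq_nat (hw.measurable_memory n hn) m) (hw.memory_uniform n hn m hm)]
  simp [div_eq_mul_inv]

/-- The `n` admissible values each carry mass `1 / n`, so no mass is left for others. -/
theorem ae_memory_mem (hw : IsMinimalRandomWalk P p q s η U) {n : ℕ} (hn : 1 ≤ n) :
    ∀ᵐ ω ∂P, U n ω ∈ Finset.Icc 1 n := by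
  have hU := hw.measurable_memory n hn
  have hS : MeasurableSet {ω | U n ω ∈ Finset.Icc 1 n} :=
    hU (t := {k | k ∈ Finset.Icc 1 n}) MeasurableSet.of_discrete
  have hsum : P.real {ω | U n ω ∈ Finset.Icc 1 n} = 1 := by
    have h : {ω | U n ω ∈ Finset.Icc 1 n} = ⋃ m ∈ Finset.Icc 1 n, {ω | U n ω = m} := by
      ext ω; simp
    rw [h, measureReal_biUnion_finset (fun i _ j _ hij => Set.disjoint_left.2 fun ω h1 h2 =>
      hij (h1.symm.trans h2)) fun m _ => measurableSet_eq_nat hU m]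
    have h1 : ∀ m ∈ Finset.Icc 1 n, P.real {ω | U n ω = m} = 1 / n := fun m hm => by
      simpa using hw.measureReal_inter_memory hn hm (A := Set.univ) MeasurableSet.univ
    rw [Finset.sum_congr rfl h1]
    have : (n : ℝ) ≠ 0 := by positivity
    simp [this]
  rw [ae_iff, ← Set.compl_ofPred, ← measureReal_eq_zero_iff, probReal_compl_eq_one_sub hS, hsum,
    sub_self]

/-- Uniform memory recalls a `1` with probability `X n / n`. This makes the position alone a Markov
chain: the rest of the history enters only through the number of past ones. -/
theorem measureReal_position_inter_step (hw : IsMinimalRandomWalk P p q s η U) {n : ℕ}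
    (hn : 1 ≤ n) (x : ℕ) :
    P.real ({ω | walkPosition η n ω = x} ∩ {ω | η (n + 1) ω = 1}) =
      (q + (p - q) * x / n) * P.real {ω | walkPosition η n ω = x} := by
  set A := {ω | walkPosition η n ω = x} with hAdef
  have hU := hw.measurable_memory n hn
  have hA : MeasurableSet[walkHistory η U n] A :=
    measurableSet_walkHistory_walkPosition η U n {x}
  have hA' : MeasurableSet A := hw.walkHistory_le n A hA
  have hm : walkHistory η U n ⊔ MeasurableSpace.comap (U n) ⊤ ≤ ‹MeasurableSpace Ω› :=
    sup_le (hw.walkHistory_le n) hU.comap_le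
  rw [measureReal_inter_eq_setIntegral hm (le_sup_left (a := walkHistory η U n) A hA)
    (measurableSet_eq_nat (hw.measurable_step (n + 1) (by omega)) 1) (hw.next_step n hn)]
  have hUm : ∀ m, MeasurableSet {ω | U n ω = m} := fun m => measurableSet_eq_nat hU m
  have hηm : ∀ m ∈ Finset.Icc 1 n, MeasurableSet {ω | η m ω = 1} := fun m hm =>
    measurableSet_eq_nat (hw.measurable_step m (Finset.mem_Icc.1 hm).1) 1
  have hae : (fun ω => if η (U n ω) ω = 1 then p else q) =ᵐ[P.restrict A] fun ω =>
      ∑ m ∈ Finset.Icc 1 n, (Set.indicator {ω | U n ω = m} (fun _ => q) ω +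
        Set.indicator ({ω | η m ω = 1} ∩ {ω | U n ω = m}) (fun _ => p - q) ω) := by
    filter_upwards [ae_restrict_of_ae (hw.ae_memory_mem hn)] with ω hω
    rw [Finset.sum_eq_single_of_mem (U n ω) hω]
    · by_cases h : η (U n ω) ω = 1 <;> simp [h]
    · intro m _ hm
      simp [Ne.symm hm]
  have hi1 : ∀ m ∈ Finset.Icc 1 n, Integrable (Set.indicator {ω | U n ω = m} fun _ => q)
      (P.restrict A) := fun m _ => (integrable_const _).indicator (hUm m)
  have hi2 : ∀ m ∈ Finset.Icc 1 n, Integrable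
      (Set.indicator ({ω | η m ω = 1} ∩ {ω | U n ω = m}) fun _ => p - q) (P.restrict A) :=
    fun m hm => (integrable_const _).indicator ((hηm m hm).inter (hUm m))
  have hi : ∀ m ∈ Finset.Icc 1 n, Integrable (fun ω =>
      Set.indicator {ω | U n ω = m} (fun _ => q) ω +
        Set.indicator ({ω | η m ω = 1} ∩ {ω | U n ω = m}) (fun _ => p - q) ω) (P.restrict A) :=
    fun m hm => (hi1 m hm).add (hi2 m hm)
  rw [integral_congr_ae hae, integral_finsetSum _ hi]
  -- Uniformity of the memory is used on two events of the history: `A`, and `A` intersected with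
  -- `{η m = 1}`.
  have hterm : ∀ m ∈ Finset.Icc 1 n,
      ∫ ω in A, (Set.indicator {ω | U n ω = m} (fun _ => q) ω +
        Set.indicator ({ω | η m ω = 1} ∩ {ω | U n ω = m}) (fun _ => p - q) ω) ∂P =
      q * P.real A / n + (p - q) / n * P.real ({ω | η m ω = 1} ∩ A) := by
    intro m hm
    rw [integral_add (hi1 m hm) (hi2 m hm), integral_indicator_const _ (hUm m),
      integral_indicator_const _ ((hηm m hm).inter (hUm m)),
      measureReal_restrict_apply (hUm m), measureReal_restrict_apply ((hηm m hm).inter (hUm m)),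
      Set.inter_comm _ A, hw.measureReal_inter_memory hn hm hA, Set.inter_right_comm,
      hw.measureReal_inter_memory hn hm (A := {ω | η m ω = 1} ∩ A)
        ((measurableSet_walkHistory_step η U hm {1}).inter hA)]
    simp only [smul_eq_mul]
    ring
  rw [Finset.sum_congr rfl hterm, Finset.sum_add_distrib, ← Finset.mul_sum]
  have hsum : ∑ m ∈ Finset.Icc 1 n, P.real ({ω | η m ω = 1} ∩ A) = x * P.real A := by
    have h1 : ∀ m ∈ Finset.Icc 1 n, P.real ({ω | η m ω = 1} ∩ A) =
        ∫ ω in A, Set.indicator {ω | η m ω = 1} (fun _ => (1 : ℝ)) ω ∂P := fun m hm => by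
      rw [integral_indicator_const _ (hηm m hm), measureReal_restrict_apply (hηm m hm)]
      simp
    rw [Finset.sum_congr rfl h1, ← integral_finsetSum _ fun m hm =>
      (integrable_const _).indicator (hηm m hm)]
    have h2 : Set.EqOn (fun ω => ∑ m ∈ Finset.Icc 1 n,
        Set.indicator {ω | η m ω = 1} (fun _ => (1 : ℝ)) ω) (fun _ => (x : ℝ)) A := by
      intro ω hω
      have hω' : walkPosition η n ω = x := hω
      simp only [← hω', walkPosition, Nat.cast_sum]
      refine Finset.sum_congr rfl fun m hm => ?_
      rcases hw.step_mem m (Finset.mem_Icc.1 hm).1 ω with h | h <;> simp [h]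
    rw [setIntegral_congr_fun hA' h2]
    simp [mul_comm]
  rw [hsum]
  have : (n : ℝ) ≠ 0 := by positivity
  simp only [Finset.sum_const, Nat.card_Icc, nsmul_eq_mul]
  simp only [add_tsub_cancel_right]
  field_simp

/-- One-step transition formula of the walk. -/
theorem integral_comp_walkPosition_succ {E : Type*} [NormedAddCommGroup E] [NormedSpace ℝ E]
    [CompleteSpace E] (hw : IsMinimalRandomWalk P p q s η U) {n : ℕ} (hn : 1 ≤ n) (h : ℕ → E) :
    ∫ ω, h (walkPosition η (n + 1) ω) ∂P =
      ∫ ω, ((q + (p - q) * walkPosition η n ω / n) • h (walkPosition η n ω + 1) +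
        (1 - (q + (p - q) * walkPosition η n ω / n)) • h (walkPosition η n ω)) ∂P := by
  have hXm := hw.measurable_walkPosition n
  have hX := hw.walkPosition_le n
  have hS : MeasurableSet {ω | η (n + 1) ω = 1} :=
    measurableSet_eq_nat (hw.measurable_step (n + 1) (by omega)) 1
  have e : (fun ω => h (walkPosition η (n + 1) ω)) = fun ω => h (walkPosition η n ω) +
      Set.indicator {ω | η (n + 1) ω = 1}
        (fun ω => h (walkPosition η n ω + 1) - h (walkPosition η n ω)) ω := by
    funext ω
    rw [walkPosition_succ]
    rcases hw.step_mem (n + 1) (by omega) ω with h0 | h1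
    · simp [h0]
    · simp [h1]
  have hi := integrable_comp_of_nat_le (P := P) hXm hX h
  have hi' := integrable_comp_of_nat_le (P := P) hXm hX (fun x => h (x + 1) - h x)
  rw [e, integral_add hi (hi'.indicator hS), integral_indicator hS,
    setIntegral_comp_of_nat_le hXm hX (fun x => h (x + 1) - h x)]
  -- On a level set of the position the integrand is constant, so the transition probability can be
  -- inserted level by level.
  have e2 : ∀ x, P.real ({ω | walkPosition η n ω = x} ∩ {ω | η (n + 1) ω = 1}) •
      (h (x + 1) - h x) = P.real ({ω | walkPosition η n ω = x} ∩ Set.univ) •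
      ((q + (p - q) * x / n) • (h (x + 1) - h x)) := fun x => by
    rw [hw.measureReal_position_inter_step hn, smul_smul, mul_comm, Set.inter_univ]
  simp_rw [e2]
  rw [← setIntegral_comp_of_nat_le hXm hX
    (fun x => (q + (p - q) * x / n) • (h (x + 1) - h x)), setIntegral_univ,
    ← integral_add hi (integrable_comp_of_nat_le hXm hX
      (fun x : ℕ => (q + (p - q) * x / n) • (h (x + 1) - h x)))]
  congr 1
  funext ω
  module

end IsMinimalRandomWalk

/-! ### Moment bounds -/

theorem harmonic_le_self {n : ℕ} (hn : 1 ≤ n) : (harmonic n : ℝ) ≤ n := by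
  have hn0 : (0 : ℝ) < n := by positivity
  have := Real.log_le_sub_one_of_pos hn0
  linarith [harmonic_le_one_add_log n]

theorem tendsto_sqrt_harmonic_div_self :
    Tendsto (fun n : ℕ => √((harmonic n : ℝ) / n)) atTop (𝓝 0) := by
  have h1 : Tendsto (fun n : ℕ => (1 + Real.log n) / n) atTop (𝓝 0) := by
    have h := (tendsto_const_div_atTop_nhds_zero_nat 1).add
      ((Real.isLittleO_log_id_atTop.tendsto_div_nhds_zero).comp tendsto_natCast_atTop_atTop)
    rw [add_zero] at h
    exact h.congr fun n => by simp [add_div]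
  have h2 : Tendsto (fun n : ℕ => (harmonic n : ℝ) / n) atTop (𝓝 0) := by
    refine squeeze_zero (fun n => ?_) (fun n => ?_) h1
    · have : (0 : ℚ) ≤ harmonic n := Finset.sum_nonneg fun i _ => by positivity
      have : (0 : ℝ) ≤ harmonic n := by exact_mod_cast this
      positivity
    · have := harmonic_le_one_add_log n
      gcongr
  have h3 := (Real.continuous_sqrt.tendsto 0).comp h2
  rwa [Real.sqrt_zero] at h3

namespace IsMinimalRandomWalk

variable {Ω : Type*} [MeasurableSpace Ω] {P : Measure Ω} {p q s : ℝ} {η U : ℕ → Ω → ℕ}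

theorem step_prob_mem (hw : IsMinimalRandomWalk P p q s η U) (hp0 : 0 ≤ p) (hp1 : p ≤ 1)
    (hq0 : 0 ≤ q) (hq1 : q ≤ 1) {n : ℕ} (hn : 1 ≤ n) (ω : Ω) :
    q + (p - q) * walkPosition η n ω / n ∈ Set.Icc (0 : ℝ) 1 := by
  have hn0 : (0 : ℝ) < n := by positivity
  set r : ℝ := walkPosition η n ω / n with hr
  have hr0 : 0 ≤ r := by positivity
  have hr1 : r ≤ 1 := by
    rw [hr, div_le_one hn0]
    exact_mod_cast hw.walkPosition_le n ω
  rw [mul_div_assoc, ← hr]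
  constructor <;> nlinarith

variable [IsProbabilityMeasure P]

/-- The second moment is multiplied by `(1 + α / n)²` and gains at most `1 / 4` per step. The worst
case `α = 1 / 2` gives order `n log n`, so one bound serves both regimes. -/
theorem integral_sq_centered_le (hw : IsMinimalRandomWalk P p q s η U) (hα0 : -1 ≤ p - q)
    (hα1 : p - q ≤ 1 / 2) {c : ℝ} (hc : q + (p - q) * c = c) (hc0 : 0 ≤ c) (hc1 : c ≤ 1)
    {n : ℕ} (hn : 1 ≤ n) :
    ∫ ω, ((walkPosition η n ω : ℝ) - c * n) ^ 2 ∂P ≤ n * (harmonic n : ℝ) := by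
  induction n, hn using Nat.le_induction with
  | base =>
    have h : ∀ ω, ((walkPosition η 1 ω : ℝ) - c * (1 : ℕ)) ^ 2 ≤ 1 := fun ω => by
      have h1 : (walkPosition η 1 ω : ℝ) ≤ 1 := by exact_mod_cast hw.walkPosition_le 1 ω
      have h0 : (0 : ℝ) ≤ walkPosition η 1 ω := by positivity
      rw [sq_le_one_iff_abs_le_one, abs_le]
      push_cast
      constructor <;> linarith
    have := integral_mono (μ := P) (integrable_comp_of_nat_le (hw.measurable_walkPosition 1)
      (hw.walkPosition_le 1) fun x : ℕ => ((x : ℝ) - c * (1 : ℕ)) ^ 2) (integrable_const 1) h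
    simpa using this
  | succ n hn ih =>
    have hn0 : (1 : ℝ) ≤ n := by exact_mod_cast hn
    have hXm := hw.measurable_walkPosition n
    have hX := hw.walkPosition_le n
    set α := p - q with hα
    rw [hw.integral_comp_walkPosition_succ hn fun x : ℕ => ((x : ℝ) - c * (n + 1 : ℕ)) ^ 2]
    have hle : ∀ ω, (q + α * walkPosition η n ω / n) •
          (((walkPosition η n ω + 1 : ℕ) : ℝ) - c * (n + 1 : ℕ)) ^ 2 +
        (1 - (q + α * walkPosition η n ω / n)) •
          ((walkPosition η n ω : ℝ) - c * (n + 1 : ℕ)) ^ 2 ≤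
        (1 + α / n) ^ 2 * ((walkPosition η n ω : ℝ) - c * n) ^ 2 + 1 / 4 := fun ω => by
      set x : ℝ := (walkPosition η n ω : ℝ) with hx
      set r := q + α * x / n with hr
      have e : (1 + α / n) * (x - c * n) = x - c * n + (r - c) := by
        rw [hr]; field_simp; linear_combination -(n : ℝ) * hc
      rw [← mul_pow, e]
      push_cast
      rw [← hx]
      simp only [smul_eq_mul]
      nlinarith [sq_nonneg (r - 1 / 2)]
    refine (integral_mono (integrable_comp_of_nat_le hXm hX fun x : ℕ =>
      (q + α * x / n) • (((x + 1 : ℕ) : ℝ) - c * (n + 1 : ℕ)) ^ 2 +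
        (1 - (q + α * x / n)) • ((x : ℝ) - c * (n + 1 : ℕ)) ^ 2)
      (integrable_comp_of_nat_le hXm hX fun x : ℕ =>
      (1 + α / n) ^ 2 * ((x : ℝ) - c * n) ^ 2 + 1 / 4) hle).trans ?_
    rw [integral_add (integrable_comp_of_nat_le hXm hX fun x : ℕ =>
      (1 + α / n) ^ 2 * ((x : ℝ) - c * n) ^ 2) (integrable_const _), integral_const_mul]
    simp only [integral_const, probReal_univ, one_smul]
    set H : ℝ := (harmonic n : ℝ) with hH
    have hHn : H ≤ n := harmonic_le_self hn
    have hH0 : 0 ≤ n * H := le_trans (integral_nonneg fun ω => sq_nonneg _) ih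
    -- Squaring is monotone here because `α ≥ -1` keeps `1 + α / n` nonnegative.
    have hfac : (1 + α / n) ^ 2 ≤ (1 + 1 / 2 / n) ^ 2 := by
      have h0 : 0 ≤ 1 + α / n := by
        have : -1 ≤ α / n := by rw [le_div_iff₀ (by linarith)]; linarith
        linarith
      gcongr
    have hs : ((harmonic (n + 1) : ℚ) : ℝ) = H + 1 / (n + 1) := by
      rw [harmonic_succ, hH]; push_cast; ring
    rw [hs]
    calc (1 + α / n) ^ 2 * ∫ ω, ((walkPosition η n ω : ℝ) - c * n) ^ 2 ∂P + 1 / 4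
        ≤ (1 + 1 / 2 / n) ^ 2 * (n * H) + 1 / 4 := by gcongr
      _ = (n + 1) * H + H / n / 4 + 1 / 4 := by field_simp; ring
      _ ≤ (n + 1) * H + 1 := by
          have : H / n ≤ 1 := by rw [div_le_one (by linarith)]; exact hHn
          linarith
      _ = (n + 1 : ℕ) * (H + 1 / (n + 1)) := by push_cast; field_simp

theorem integral_abs_centered_div_le (hw : IsMinimalRandomWalk P p q s η U) (hα0 : -1 ≤ p - q)
    (hα1 : p - q ≤ 1 / 2) {c : ℝ} (hc : q + (p - q) * c = c) (hc0 : 0 ≤ c) (hc1 : c ≤ 1)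
    {n : ℕ} (hn : 1 ≤ n) :
    ∫ ω, |(walkPosition η n ω : ℝ) - c * n| / n ∂P ≤ √((harmonic n : ℝ) / n) := by
  have hn0 : (0 : ℝ) < n := by positivity
  have hXm := hw.measurable_walkPosition n
  have hX := hw.walkPosition_le n
  have hH : (0 : ℝ) < harmonic n := by exact_mod_cast harmonic_pos (by omega : n ≠ 0)
  set δ := √((harmonic n : ℝ) / n) with hδ
  have hδ0 : 0 < δ := Real.sqrt_pos.2 (by positivity)
  have hδ2 : δ ^ 2 = harmonic n / n := Real.sq_sqrt (by positivity)
  -- Cauchy–Schwarz in the form `a ≤ a² / (2δ) + δ / 2`, with `δ` equal to the target bound.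
  have hle : ∀ ω, |(walkPosition η n ω : ℝ) - c * n| / n ≤
      1 / (2 * δ * n ^ 2) * ((walkPosition η n ω : ℝ) - c * n) ^ 2 + δ / 2 := fun ω => by
    rw [← sq_abs ((walkPosition η n ω : ℝ) - c * n)]
    set y := |(walkPosition η n ω : ℝ) - c * n|
    have : 1 / (2 * δ * n ^ 2) * y ^ 2 + δ / 2 - y / n = (y / n - δ) ^ 2 / (2 * δ) := by
      field_simp; ring
    have h2 : 0 ≤ (y / n - δ) ^ 2 / (2 * δ) := by positivity
    linarith
  refine (integral_mono (integrable_comp_of_nat_le hXm hX fun x : ℕ => |(x : ℝ) - c * n| / n)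
    (integrable_comp_of_nat_le hXm hX fun x : ℕ =>
      1 / (2 * δ * n ^ 2) * ((x : ℝ) - c * n) ^ 2 + δ / 2) hle).trans ?_
  rw [integral_add (integrable_comp_of_nat_le hXm hX fun x : ℕ =>
    1 / (2 * δ * n ^ 2) * ((x : ℝ) - c * n) ^ 2) (integrable_const _), integral_const_mul]
  simp only [integral_const, probReal_univ, one_smul]
  have h := hw.integral_sq_centered_le hα0 hα1 hc hc0 hc1 hn
  calc 1 / (2 * δ * n ^ 2) * ∫ ω, ((walkPosition η n ω : ℝ) - c * n) ^ 2 ∂P + δ / 2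
      ≤ 1 / (2 * δ * n ^ 2) * (n * harmonic n) + δ / 2 := by gcongr
    _ = 1 / (2 * δ) * (harmonic n / n) + δ / 2 := by field_simp
    _ = δ := by rw [← hδ2]; field_simp; norm_num

/-! ### Recursion for the characteristic functions -/

theorem norm_charFun_centered_sub_one_le (hw : IsMinimalRandomWalk P p q s η U) (c : ℝ) (n : ℕ)
    (u : ℝ) :
    ‖∫ ω, Complex.exp ((u * ((walkPosition η n ω : ℝ) - c * n) : ℝ) * Complex.I) ∂P - 1‖ ≤
      (∫ ω, |(walkPosition η n ω : ℝ) - c * n| ∂P) * |u| := by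
  have hXm := hw.measurable_walkPosition n
  have hX := hw.walkPosition_le n
  have h1 : ∫ ω, Complex.exp ((u * ((walkPosition η n ω : ℝ) - c * n) : ℝ) * Complex.I) ∂P - 1 =
      ∫ ω, (Complex.exp ((u * ((walkPosition η n ω : ℝ) - c * n) : ℝ) * Complex.I) - 1) ∂P := by
    rw [integral_sub (integrable_comp_of_nat_le hXm hX fun x : ℕ =>
      Complex.exp ((u * ((x : ℝ) - c * n) : ℝ) * Complex.I)) (integrable_const _)]
    simp
  rw [h1, ← integral_mul_const]
  refine norm_integral_le_of_norm_le
    (integrable_comp_of_nat_le hXm hX fun x : ℕ => |(x : ℝ) - c * n| * |u|) (ae_of_all _ fun ω => ?_)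
  have := Real.norm_exp_I_mul_ofReal_sub_one_le (x := u * ((walkPosition η n ω : ℝ) - c * n))
  rw [mul_comm Complex.I, Real.norm_eq_abs, abs_mul, mul_comm |u|] at this
  exact this

/-- Conditionally on the position, the drift is absorbed into the factor `1 + (p - q) / n`, leaving
a centered Bernoulli factor. Its Taylor error gives `|u|³`; replacing its variance by `c (1 - c)`
costs `u²` times the mean of `|X n - c n| / n`. -/
theorem norm_charFun_centered_succ_sub_le (hw : IsMinimalRandomWalk P p q s η U)
    (hp0 : 0 ≤ p) (hp1 : p ≤ 1) (hq0 : 0 ≤ q) (hq1 : q ≤ 1)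
    (hα1 : p - q ≤ 1 / 2) {c : ℝ} (hc : q + (p - q) * c = c) (hc0 : 0 ≤ c) (hc1 : c ≤ 1)
    {n : ℕ} (hn : 1 ≤ n) {u : ℝ} (hu : |u| ≤ 1) :
    ‖∫ ω, Complex.exp ((u * ((walkPosition η (n + 1) ω : ℝ) - c * (n + 1 : ℕ)) : ℝ) *
          Complex.I) ∂P -
        ((1 - c * (1 - c) * u ^ 2 / 2 : ℝ) : ℂ) *
        ∫ ω, Complex.exp (((1 + (p - q) / n) * u * ((walkPosition η n ω : ℝ) - c * n) : ℝ) *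
          Complex.I) ∂P‖ ≤ u ^ 2 * (|u| + √((harmonic n : ℝ) / n)) := by
  have hn0 : (0 : ℝ) < n := by positivity
  have hXm := hw.measurable_walkPosition n
  have hX := hw.walkPosition_le n
  set α := p - q with hα
  have hαabs : |α| ≤ 1 := abs_le.2 ⟨by linarith, by linarith⟩
  rw [hw.integral_comp_walkPosition_succ hn fun x : ℕ =>
    Complex.exp ((u * ((x : ℝ) - c * (n + 1 : ℕ)) : ℝ) * Complex.I), ← integral_const_mul,
    ← integral_sub (integrable_comp_of_nat_le hXm hX fun x : ℕ =>
      (q + α * x / n) •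
        Complex.exp ((u * (((x + 1 : ℕ) : ℝ) - c * (n + 1 : ℕ)) : ℝ) * Complex.I) +
      (1 - (q + α * x / n)) • Complex.exp ((u * ((x : ℝ) - c * (n + 1 : ℕ)) : ℝ) * Complex.I))
    (integrable_comp_of_nat_le hXm hX fun x : ℕ => ((1 - c * (1 - c) * u ^ 2 / 2 : ℝ) : ℂ) *
      Complex.exp (((1 + α / n) * u * ((x : ℝ) - c * n) : ℝ) * Complex.I))]
  have hle : ∀ ω, ‖((q + α * walkPosition η n ω / n) •
        Complex.exp ((u * (((walkPosition η n ω + 1 : ℕ) : ℝ) - c * (n + 1 : ℕ)) : ℝ) * Complex.I) +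
      (1 - (q + α * walkPosition η n ω / n)) •
        Complex.exp ((u * ((walkPosition η n ω : ℝ) - c * (n + 1 : ℕ)) : ℝ) * Complex.I)) -
      ((1 - c * (1 - c) * u ^ 2 / 2 : ℝ) : ℂ) *
      Complex.exp (((1 + α / n) * u * ((walkPosition η n ω : ℝ) - c * n) : ℝ) * Complex.I)‖ ≤
      u ^ 2 * |u| + u ^ 2 * (|(walkPosition η n ω : ℝ) - c * n| / n) := fun ω => by
    obtain ⟨hr0, hr1⟩ := hw.step_prob_mem hp0 hp1 hq0 hq1 hn ω
    rw [← hα] at hr0 hr1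
    rw [Nat.cast_succ, Nat.cast_succ]
    set x : ℝ := (walkPosition η n ω : ℝ) with hx
    set r := q + α * x / n with hr
    set y := x - c * n with hy
    have hrc : r - c = α * y / n := by
      rw [hr, hy]; field_simp; linear_combination (n : ℝ) * hc
    have hby : (1 + α / n) * y = y + (r - c) := by rw [hrc]; ring
    set E := Complex.exp (((1 + α / n) * u * y : ℝ) * Complex.I) with hE
    set g := r * Complex.exp ((u * (1 - r) : ℝ) * Complex.I)
        + (1 - r) * Complex.exp ((-(u * r) : ℝ) * Complex.I) with hg
    have hg1 := norm_centered_bernoulli_charFun_sub_le hr0 hr1 hu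
    rw [← hg] at hg1
    have e1 : Complex.exp ((u * (x + 1 - c * (n + 1)) : ℝ) * Complex.I) =
        E * Complex.exp ((u * (1 - r) : ℝ) * Complex.I) := by
      rw [hE, ← Complex.exp_add, ← add_mul, ← Complex.ofReal_add]
      congr 3
      linear_combination -u * hby + u * hy
    have e2 : Complex.exp ((u * (x - c * (n + 1)) : ℝ) * Complex.I) =
        E * Complex.exp ((-(u * r) : ℝ) * Complex.I) := by
      rw [hE, ← Complex.exp_add, ← add_mul, ← Complex.ofReal_add]
      congr 3
      linear_combination -u * hby + u * hy
    have key : (r • Complex.exp ((u * (x + 1 - c * (n + 1)) : ℝ) * Complex.I) +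
        (1 - r) • Complex.exp ((u * (x - c * (n + 1)) : ℝ) * Complex.I)) -
        ((1 - c * (1 - c) * u ^ 2 / 2 : ℝ) : ℂ) * E =
        E * ((g - ((1 - r * (1 - r) * u ^ 2 / 2 : ℝ) : ℂ)) +
          ((u ^ 2 / 2 * (c * (1 - c) - r * (1 - r)) : ℝ) : ℂ)) := by
      rw [e1, e2, hg, Complex.real_smul, Complex.real_smul]
      push_cast
      ring
    -- The difference of variances factors as `(r - c) * (r + c - 1)`, the second factor being at
    -- most `1` in modulus.
    have hvar : |c * (1 - c) - r * (1 - r)| ≤ |y| / n := by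
      have h1 : c * (1 - c) - r * (1 - r) = (α * y / n) * (r + c - 1) := by rw [← hrc]; ring
      rw [h1, abs_mul, abs_div, abs_mul, abs_of_pos hn0]
      have h2 : |r + c - 1| ≤ 1 := abs_le.2 ⟨by linarith, by linarith⟩
      calc |α| * |y| / n * |r + c - 1| ≤ 1 * |y| / n * 1 := by gcongr
        _ = |y| / n := by ring
    have hmain : ‖E * ((g - ((1 - r * (1 - r) * u ^ 2 / 2 : ℝ) : ℂ)) +
          ((u ^ 2 / 2 * (c * (1 - c) - r * (1 - r)) : ℝ) : ℂ))‖ ≤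
        u ^ 2 * |u| + u ^ 2 * (|y| / n) := by
      rw [norm_mul, hE, Complex.norm_exp_ofReal_mul_I, one_mul]
      refine (norm_add_le _ _).trans (add_le_add (hg1.trans ?_) ?_)
      · rw [← sq_abs u]; exact (pow_succ _ _).le
      · rw [Complex.norm_real, Real.norm_eq_abs, abs_mul, abs_of_nonneg (by positivity)]
        have : 0 ≤ u ^ 2 := sq_nonneg u
        gcongr
        linarith
    rwa [← key] at hmain
  have hi2 := integrable_comp_of_nat_le (P := P) hXm hX fun x : ℕ =>
    u ^ 2 * (|(x : ℝ) - c * n| / n)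
  refine (norm_integral_le_of_norm_le ((integrable_const (u ^ 2 * |u|)).add hi2)
    (ae_of_all _ hle)).trans ?_
  rw [integral_add' (integrable_const _) hi2]
  simp only [integral_const, probReal_univ, one_smul, integral_const_mul]
  have := hw.integral_abs_centered_div_le (by linarith) hα1 hc hc0 hc1 hn
  rw [mul_add]
  exact add_le_add_right (mul_le_mul_of_nonneg_left this (sq_nonneg u)) _

theorem tendsto_charFun_centered (hw : IsMinimalRandomWalk P p q s η U)
    (hp0 : 0 ≤ p) (hp1 : p ≤ 1) (hq0 : 0 ≤ q) (hq1 : q ≤ 1)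
    (hα1 : p - q ≤ 1 / 2) {c : ℝ} (hc : q + (p - q) * c = c) (hc0 : 0 ≤ c) (hc1 : c ≤ 1)
    {L Λ : ℕ → ℝ} {κ : ℝ} (hκ : 0 < κ) (hL : Tendsto L atTop atTop)
    (hLκ : Tendsto (fun n : ℕ => L (n + 1) - (1 + (p - q) / n) ^ 2 * L n) atTop (𝓝 κ))
    (hΛ : Tendsto Λ atTop atTop) (hΛL : ∀ᶠ n in atTop, Λ (n + 1) - Λ n ≤ 1 / L (n + 1)) (t : ℝ) :
    Tendsto (fun n => ∫ ω, Complex.exp ((t / √(L n) * ((walkPosition η n ω : ℝ) - c * n) : ℝ) *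
      Complex.I) ∂P) atTop (𝓝 (Real.exp (-(c * (1 - c) / κ) * t ^ 2 / 2) : ℝ)) := by
  refine tendsto_gaussian_of_approx_recursion (F := fun n u =>
      ∫ ω, Complex.exp ((u * ((walkPosition η n ω : ℝ) - c * n) : ℝ) * Complex.I) ∂P)
    (β := fun n => 1 + (p - q) / n) (e := fun n => √((harmonic n : ℝ) / n))
    (mul_nonneg hc0 (by linarith)) (by nlinarith) hκ (fun n hn => ?_) (fun n => Real.sqrt_nonneg _)
    tendsto_sqrt_harmonic_div_self
    (fun n hn u hu => hw.norm_charFun_centered_succ_sub_le hp0 hp1 hq0 hq1 hα1 hc hc0 hc1 hn hu)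
    (fun n => ⟨_, integral_nonneg fun ω => abs_nonneg _,
      hw.norm_charFun_centered_sub_one_le c n⟩) hL hLκ hΛ hΛL t
  have hn1 : (1 : ℝ) ≤ n := by exact_mod_cast hn
  have : -1 ≤ (p - q) / n := by rw [le_div_iff₀ (by linarith)]; linarith
  linarith

theorem tendstoInDistribution_centered (hw : IsMinimalRandomWalk P p q s η U)
    (hp0 : 0 ≤ p) (hp1 : p ≤ 1) (hq0 : 0 ≤ q) (hq1 : q ≤ 1)
    (hα1 : p - q ≤ 1 / 2) {c : ℝ} (hc : q + (p - q) * c = c) (hc0 : 0 ≤ c) (hc1 : c ≤ 1)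
    {L Λ : ℕ → ℝ} {κ : ℝ} (hκ : 0 < κ) (hL : Tendsto L atTop atTop)
    (hLκ : Tendsto (fun n : ℕ => L (n + 1) - (1 + (p - q) / n) ^ 2 * L n) atTop (𝓝 κ))
    (hΛ : Tendsto Λ atTop atTop) (hΛL : ∀ᶠ n in atTop, Λ (n + 1) - Λ n ≤ 1 / L (n + 1)) :
    TendstoInDistribution
      (fun (n : ℕ) (ω : Ω) => ((walkPosition η n ω : ℝ) - c * n) / √(L n))
      atTop (id : ℝ → ℝ) (fun _ => P)
      (gaussianReal 0 (Real.toNNReal (c * (1 - c) / κ))) := by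
  have hmeas : ∀ n, Measurable fun ω => ((walkPosition η n ω : ℝ) - c * n) / √(L n) := fun n =>
    ((measurable_from_nat.comp (hw.measurable_walkPosition n)).sub_const _).div_const _
  refine ⟨fun n => (hmeas n).aemeasurable, aemeasurable_id, ?_⟩
  refine ProbabilityMeasure.tendsto_iff_tendsto_charFun.2 fun t => ?_
  have hv : 0 ≤ c * (1 - c) / κ := div_nonneg (mul_nonneg hc0 (by linarith)) hκ.le
  simp only [ProbabilityMeasure.coe_mk, Measure.map_id]
  rw [charFun_gaussianReal, Real.coe_toNNReal _ hv]
  convert hw.tendsto_charFun_centered hp0 hp1 hq0 hq1 hα1 hc hc0 hc1 hκ hL hLκ hΛ hΛL t using 2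
  · rw [charFun_apply_real, integral_map (hmeas _).aemeasurable (by fun_prop)]
    congr 1
    funext ω
    push_cast
    ring_nf
  · push_cast
    ring_nf

end IsMinimalRandomWalk

/-! ### Normalizing sequences and the two regimes -/

theorem Real.log_succ_sub_log_le {x : ℝ} (hx : 0 < x) :
    Real.log (x + 1) - Real.log x ≤ 1 / x := by
  rw [← Real.log_div (by linarith) hx.ne']
  refine (Real.log_le_sub_one_of_pos (by positivity)).trans (le_of_eq ?_)
  field_simp; ring

theorem Real.one_div_succ_le_log_succ_sub_log {x : ℝ} (hx : 0 < x) :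
    1 / (x + 1) ≤ Real.log (x + 1) - Real.log x := by
  have h := Real.log_le_sub_one_of_pos (x := x / (x + 1)) (by positivity)
  rw [Real.log_div hx.ne' (by linarith)] at h
  have : x / (x + 1) - 1 = -(1 / (x + 1)) := by field_simp; ring
  linarith

theorem tendsto_succ_sub_sq_mul_self (α : ℝ) :
    Tendsto (fun n : ℕ => ((n + 1 : ℕ) : ℝ) - (1 + α / n) ^ 2 * n) atTop (𝓝 (1 - 2 * α)) := by
  have h : Tendsto (fun n : ℕ => 1 - 2 * α - α ^ 2 / n) atTop (𝓝 (1 - 2 * α)) := by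
    simpa using (tendsto_const_div_atTop_nhds_zero_nat (α ^ 2)).const_sub (1 - 2 * α)
  refine h.congr' ?_
  filter_upwards [eventually_ge_atTop 1] with n hn
  have : (0 : ℝ) < n := by positivity
  push_cast; field_simp; ring

theorem tendsto_succ_mul_log_sub :
    Tendsto (fun n : ℕ => ((n + 1 : ℕ) : ℝ) * Real.log (n + 1 : ℕ) -
      (1 + 1 / 2 / (n : ℝ)) ^ 2 * (n * Real.log n)) atTop (𝓝 1) := by
  have h1 : Tendsto (fun n : ℕ => ((n : ℝ) + 1) * (Real.log (n + 1) - Real.log n)) atTop (𝓝 1) := by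
    have hup : Tendsto (fun n : ℕ => 1 + 1 / (n : ℝ)) atTop (𝓝 1) := by
      simpa using (tendsto_const_div_atTop_nhds_zero_nat (1 : ℝ)).const_add 1
    refine tendsto_of_tendsto_of_tendsto_of_le_of_le' tendsto_const_nhds hup ?_ ?_
    · filter_upwards [eventually_ge_atTop 1] with n hn
      have hn0 : (0 : ℝ) < n := by positivity
      have := Real.one_div_succ_le_log_succ_sub_log hn0
      rwa [div_le_iff₀' (by positivity)] at this
    · filter_upwards [eventually_ge_atTop 1] with n hn
      have hn0 : (0 : ℝ) < n := by positivity
      have := mul_le_mul_of_nonneg_left (Real.log_succ_sub_log_le hn0)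
        (by positivity : (0 : ℝ) ≤ n + 1)
      refine this.trans (le_of_eq ?_)
      field_simp
  have h2 : Tendsto (fun n : ℕ => Real.log n / n) atTop (𝓝 0) :=
    (Real.isLittleO_log_id_atTop.tendsto_div_nhds_zero).comp tendsto_natCast_atTop_atTop
  have h3 := h1.sub (h2.div_const 4)
  rw [zero_div, sub_zero] at h3
  refine h3.congr' ?_
  filter_upwards [eventually_ge_atTop 1] with n hn
  have hn0 : (0 : ℝ) < n := by positivity
  push_cast; field_simp; ring

theorem theorem2 {Ω : Type*} [MeasurableSpace Ω] (P : Measure Ω) [IsProbabilityMeasure P]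
    (p q s α : ℝ) (hp0 : 0 ≤ p) (hp1 : p < 1) (hq0 : 0 < q) (hq1 : q ≤ 1)
    (hs0 : 0 ≤ s) (hs1 : s ≤ 1) (hα : α = p - q) (hα_le : α ≤ 1 / 2)
    (η U : ℕ → Ω → ℕ) (hwalk : IsMinimalRandomWalk P p q s η U) :
    (α < 1 / 2 →
      TendstoInDistribution
        (fun (n : ℕ) (ω : Ω) =>
          ((walkPosition η n ω : ℝ) - q / (1 - α) * (n : ℝ)) / Real.sqrt (n : ℝ))
        atTop (id : ℝ → ℝ) (fun _ => P)
        (gaussianReal 0 (Real.toNNReal (q * (1 - p) / ((1 - α) ^ 2 * (1 - 2 * α)))))) ∧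
    (α = 1 / 2 →
      TendstoInDistribution
        (fun (n : ℕ) (ω : Ω) =>
          ((walkPosition η n ω : ℝ) - 2 * q * (n : ℝ)) / Real.sqrt ((n : ℝ) * Real.log (n : ℝ)))
        atTop (id : ℝ → ℝ) (fun _ => P)
        (gaussianReal 0 (Real.toNNReal (4 * q * (1 - p))))) := by
  have hα1 : 0 < 1 - α := by linarith
  have hc : q + (p - q) * (q / (1 - α)) = q / (1 - α) := by
    rw [← hα]; field_simp; ring
  have hc0 : 0 ≤ q / (1 - α) := by positivity
  have hc1 : q / (1 - α) ≤ 1 := by rw [div_le_one hα1]; linarith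
  have hvar : q / (1 - α) * (1 - q / (1 - α)) = q * (1 - p) / (1 - α) ^ 2 := by
    have : p = α + q := by linarith
    rw [this]; field_simp; ring
  have hlog : Tendsto (fun n : ℕ => Real.log ((n : ℝ) + 1)) atTop atTop :=
    Real.tendsto_log_atTop.comp (tendsto_atTop_add_const_right _ 1 tendsto_natCast_atTop_atTop)
  constructor
  · intro hlt
    have hκ : 0 < 1 - 2 * α := by linarith
    have := hwalk.tendstoInDistribution_centered hp0 hp1.le hq0.le hq1 (hα ▸ hα_le) hc hc0 hc1
      -- The shift in `log (n + 1)` matches `1 / L (n + 1)`: the increment is `log (n + 2) - log (n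
      -- + 1) ≤ 1 / (n + 1)`.
      (L := fun n => n) (Λ := fun n => Real.log (n + 1)) hκ tendsto_natCast_atTop_atTop
      (hα ▸ tendsto_succ_sub_sq_mul_self α) hlog (Eventually.of_forall fun n => by
        push_cast
        exact Real.log_succ_sub_log_le (by positivity))
    rwa [hvar, div_div] at this
  · intro heq
    have hL : Tendsto (fun n : ℕ => (n : ℝ) * Real.log n) atTop atTop :=
      tendsto_natCast_atTop_atTop.atTop_mul_atTop₀
        (Real.tendsto_log_atTop.comp tendsto_natCast_atTop_atTop)
    have := hwalk.tendstoInDistribution_centered hp0 hp1.le hq0.le hq1 (hα ▸ hα_le) hc hc0 hc1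
      -- `log log` is the growth of the partial sums of `1 / (n log n)`, whose divergence is what
      -- the contraction needs.
      (L := fun n => n * Real.log n) (Λ := fun n => Real.log (Real.log (n + 1))) one_pos hL
      (by rw [← hα, heq]; exact tendsto_succ_mul_log_sub) (Real.tendsto_log_atTop.comp hlog) (by
        filter_upwards [eventually_ge_atTop 1] with n hn
        have hn0 : (0 : ℝ) < n := by positivity
        have hl : 0 < Real.log ((n : ℝ) + 1) := Real.log_pos (by linarith)
        have hl2 : 0 < Real.log ((n : ℝ) + 1 + 1) := Real.log_pos (by linarith)
        have h1 := Real.log_succ_sub_log_le (x := (n : ℝ) + 1) (by positivity)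
        push_cast
        rw [← Real.log_div hl2.ne' hl.ne']
        refine (Real.log_le_sub_one_of_pos (by positivity)).trans ?_
        rw [div_sub_one hl.ne', ← div_div]
        gcongr)
    have e1 : q / (1 - α) = 2 * q := by rw [heq]; ring
    have e2 : q * (1 - p) / (1 - α) ^ 2 / 1 = 4 * q * (1 - p) := by rw [heq]; ring
    rwa [hvar, e1, e2] at this
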